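/- Let $J:\mathbb{R}^p\to\mathbb{R}$ be a finite-valued convex function with subdifferential $\partial J$. For $\beta\in\mathbb{R}^p$ let $T_\beta$ be the orthogonal complement of the linear span of $\{\eta-\eta' : \eta,\eta'\in\partial J(\beta)\}$. The function $J$ is called partly smooth at $\beta$ relative to a set $\mathcal{M}\ni\beta$ if (i) $\mathcal{M}$ is a $C^2$-manifold around $\beta$ (an embedded one: near $\beta$ it is the zero set of a $C^2$ map with values in some $\mathbb{R}^m$ whose derivative at $\beta$ is surjective) and $J$ restricted to $\mathcal{M}$ is $C^2$ around $\beta$; (ii) the tangent space of $\mathcal{M}$ at $\beta$ is $T_\beta$; (iii) the set-valued map $\partial J$ is continuous (inner and outer semicontinuous) at $\beta$ relative to $\mathcal{M}$. It is called locally partly smooth at $\beta$ relative to $\mathcal{M}\ni\beta$ if $\mathcal{M}$ is a $C^2$-manifold and $J$ is partly smooth relative to $\mathcal{M}$ at all points of $\mathcal{M}$ in some neighbourhood of $\beta$. Let $\beta_0\in\mathbb{R}^p$, let $J$ be locally partly smooth at $\beta_0$ relative to $\mathcal{M}$, put $T=T_{\beta_0}$, and let $P_T$ be the orthogonal projection onto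 $T$. All elements of $\partial J(\beta_0)$ have the same projection onto $T$, denoted $e$. For $\Gamma\in\mathbb{R}^{p\times p}$ put $\Gamma_T=P_T\Gamma P_T$ and $\eta_\Gamma=\Gamma\,\Gamma_T^{+}\,e$, where $A^+$ is the Moore–Penrose pseudo-inverse of $A$. For $\mu>0$, $u\in\mathbb{R}^p$ and a symmetric positive semidefinite $\Gamma\in\mathbb{R}^{p\times p}$ consider, with $\theta=(\mu,u,\Gamma)$, $$\min_{\beta\in\mathbb{R}^p}\Big\{J(\beta)+\tfrac{1}{2\mu}\langle\Gamma\beta,\beta\rangle-\tfrac1\mu\langle\beta,u\rangle+\tfrac1{2\mu}\langle\Gamma^+u,u\rangle\Big\}.\qquad(\mathcal{P}_\theta)$$ **Proposition 1.** Let $\tilde\Gamma\in\mathbb{R}^{p\times p}$. Suppose that $\beta_0$ is the unique minimizer of $J$ over $\{\beta\in\mathbb{R}^p : \tilde\Gamma\beta=\tilde\Gamma\beta_0\}$, that $\ker(\tilde\Gamma)\cap T=\{0\}$, and that $\eta_{\tilde\Gamma}\notin\partial J(\beta_0)$. Then there exists a constant $C>0$ such that for all $\mu>0$, all $u\in\mathbb{R}^p$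 and all symmetric positive semidefinite $\Gamma\in\mathbb{R}^{p\times p}$ with $$\max\big(\|\Gamma-\tilde\Gamma\|,\ \|u-\Gamma\beta_0\|\,\mu^{-1},\ \mu\big)\le C,$$ every solution $\beta_\theta$ of $(\mathcal{P}_\theta)$ satisfies $\beta_\theta\notin\mathcal{M}$. -/

import Mathlib

open Set Filter Topology
open scoped InnerProductSpace

noncomputable section

namespace PartlySmoothModel

/-- The Euclidean space `ℝ^p`. -/
abbrev Vec (p : ℕ) : Type := EuclideanSpace ℝ (Fin p)

/-- The operator of `ℝ^p` given by a real `p × p` matrix; the norm on operators is the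
operator norm induced by the Euclidean norm. -/
abbrev op {p : ℕ} (Γ : Matrix (Fin p) (Fin p) ℝ) : Vec p →L[ℝ] Vec p :=
  Matrix.toEuclideanCLM (𝕜 := ℝ) Γ

/-! ### The Moore-Penrose pseudo-inverse -/

/-- `B` satisfies the four Penrose equations for `A`. -/
structure IsMoorePenroseInverse {p : ℕ} (A B : Vec p →L[ℝ] Vec p) : Prop where
  mul_mul_left : A * B * A = A
  mul_mul_right : B * A * B = B
  selfAdjoint_left : IsSelfAdjoint (A * B)
  selfAdjoint_right : IsSelfAdjoint (B * A)

theorem exists_isMoorePenroseInverse {p : ℕ} (A : Vec p →L[ℝ] Vec p) :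
    ∃ B, IsMoorePenroseInverse A B := by
  set K : Submodule ℝ (Vec p) := LinearMap.ker (A : Vec p →ₗ[ℝ] Vec p) with hK
  set R : Submodule ℝ (Vec p) := LinearMap.range (A : Vec p →ₗ[ℝ] Vec p) with hR
  have hA : ∀ x, A (Kᗮ.starProjection x) = A x := by
    intro x
    have h1 : x - Kᗮ.starProjection x ∈ K := by
      have := Kᗮ.sub_starProjection_mem_orthogonal x
      rwa [Submodule.orthogonal_orthogonal] at this
    have h2 : A (x - Kᗮ.starProjection x) = 0 := h1
    rw [map_sub, sub_eq_zero] at h2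
    exact h2.symm
  let f : Kᗮ →ₗ[ℝ] R := (A : Vec p →ₗ[ℝ] Vec p).rangeRestrict.comp Kᗮ.subtype
  have hfc : ∀ x : Kᗮ, ((f x : R) : Vec p) = A x := fun x => rfl
  have hbij : Function.Bijective f := by
    constructor
    · rw [← LinearMap.ker_eq_bot, LinearMap.ker_eq_bot']
      intro x hx
      have h1 : A (x : Vec p) = 0 := by rw [← hfc x, hx]; rfl
      have h2 : (x : Vec p) ∈ K := h1
      have h3 : (x : Vec p) ∈ K ⊓ Kᗮ := ⟨h2, x.2⟩
      rw [Submodule.inf_orthogonal_eq_bot] at h3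
      exact Subtype.ext h3
    · rintro ⟨y, x, rfl⟩
      exact ⟨⟨Kᗮ.starProjection x, Kᗮ.starProjection_apply_mem x⟩, Subtype.ext (hA x)⟩
  let F : Kᗮ ≃ₗ[ℝ] R := LinearEquiv.ofBijective f hbij
  let B₀ : Vec p →ₗ[ℝ] Vec p :=
    Kᗮ.subtype.comp
      ((F.symm : R →ₗ[ℝ] Kᗮ).comp (R.orthogonalProjectionOnto : Vec p →ₗ[ℝ] R))
  let B : Vec p →L[ℝ] Vec p := LinearMap.toContinuousLinearMap B₀
  have hB : ∀ y, B y = (F.symm (R.orthogonalProjectionOnto y) : Vec p) := fun y => rfl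
  have hAB : A * B = R.starProjection := by
    ext1 y
    change A (B y) = _
    rw [hB, ← hfc]
    have : f (F.symm (R.orthogonalProjectionOnto y)) = R.orthogonalProjectionOnto y :=
      F.apply_symm_apply _
    rw [this]; rfl
  have hBA : B * A = Kᗮ.starProjection := by
    ext1 x
    change B (A x) = _
    have h1 : R.orthogonalProjectionOnto (A x)
        = F ⟨Kᗮ.starProjection x, Kᗮ.starProjection_apply_mem x⟩ := by
      apply Subtype.ext
      have h2 : ((R.orthogonalProjectionOnto (A x) : R) : Vec p) = A x :=
        Submodule.starProjection_eq_self_iff.2 (⟨x, rfl⟩ : A x ∈ R)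
      rw [h2]
      exact (hA x).symm
    rw [hB, h1, F.symm_apply_apply]
  refine ⟨B, ?_, ?_, ?_, ?_⟩
  · rw [mul_assoc, hBA]
    ext1 x
    exact hA x
  · rw [hBA]
    ext1 y
    change Kᗮ.starProjection (B y) = B y
    exact Submodule.starProjection_eq_self_iff.2 (Subtype.coe_prop _)
  · rw [hAB]
    exact isSelfAdjoint_starProjection R
  · rw [hBA]
    exact isSelfAdjoint_starProjection Kᗮ

/-- The Moore-Penrose pseudo-inverse `A⁺`. -/
def pinv {p : ℕ} (A : Vec p →L[ℝ] Vec p) : Vec p →L[ℝ] Vec p :=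
  (exists_isMoorePenroseInverse A).choose

theorem pinv_spec {p : ℕ} (A : Vec p →L[ℝ] Vec p) : IsMoorePenroseInverse A (pinv A) :=
  (exists_isMoorePenroseInverse A).choose_spec

/-! ### Subdifferential, model subspace and model vector -/

/-- The convex subdifferential `∂J(β)`. -/
def subdiff {p : ℕ} (J : Vec p → ℝ) (β : Vec p) : Set (Vec p) :=
  {η | ∀ γ : Vec p, J β + ⟪η, γ - β⟫_ℝ ≤ J γ}

/-- The tangent model subspace `T_β`: the orthogonal complement of the linear hull
(the span of the differences) of `∂J(β)`. -/
def modelSubspace {p : ℕ} (J : Vec p → ℝ) (β : Vec p) : Submodule ℝ (Vec p) :=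
  (vectorSpan ℝ (subdiff J β))ᗮ

open Classical in
/-- The model vector `e`: the single element of the image of `∂J(β)` under the orthogonal
projection onto `T_β`. It does not depend on the subgradient chosen, see
`starProjection_eq_modelVector`. (The value `0` when `∂J(β)` is empty is never relevant: the
subdifferential of a finite convex function on `ℝ^p` is nonempty.) -/
def modelVector {p : ℕ} (J : Vec p → ℝ) (β : Vec p) : Vec p :=
  if h : (subdiff J β).Nonempty then (modelSubspace J β).starProjection h.some else 0

theorem starProjection_eq_modelVector {p : ℕ} {J : Vec p → ℝ} {β η : Vec p}
    (hη : η ∈ subdiff J β) : (modelSubspace J β).starProjection η = modelVector J β := by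
  have hne : (subdiff J β).Nonempty := ⟨η, hη⟩
  rw [modelVector, dif_pos hne, ← sub_eq_zero, ← map_sub]
  rw [Submodule.starProjection_apply_eq_zero_iff]
  unfold modelSubspace
  rw [Submodule.orthogonal_orthogonal]
  exact vsub_mem_vectorSpan ℝ hη hne.some_mem

/-- `Γ_T = P_T Γ P_T`, where `P_T` is the orthogonal projection onto `T`. -/
def compress {p : ℕ} (T : Submodule ℝ (Vec p)) (Γ : Matrix (Fin p) (Fin p) ℝ) :
    Vec p →L[ℝ] Vec p :=
  T.starProjection * op Γ * T.starProjection

/-- The linearized pre-certificate `η_Γ = Γ (Γ_T)⁺ e`, with `T = T_β` and `e = P_T (∂J(β))`. -/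
def preCertificate {p : ℕ} (J : Vec p → ℝ) (β : Vec p) (Γ : Matrix (Fin p) (Fin p) ℝ) : Vec p :=
  op Γ (pinv (compress (modelSubspace J β) Γ) (modelVector J β))

/-! ### Manifolds and partial smoothness -/

/-- `Φ` is a `C²` submersion at `β` whose zero set is `M` near `β`. -/
structure IsLocalDefiningMap {p m : ℕ} (M : Set (Vec p)) (β : Vec p) (Φ : Vec p → Vec m) :
    Prop where
  contDiffAt : ContDiffAt ℝ 2 Φ β
  surjective : Function.Surjective (fderiv ℝ Φ β)
  mem_iff : ∀ᶠ x in 𝓝 β, x ∈ M ↔ Φ x = 0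

/-- `M` contains `β` and is an (embedded) `C²`-manifold around `β`. -/
def IsC2ManifoldAround {p : ℕ} (M : Set (Vec p)) (β : Vec p) : Prop :=
  β ∈ M ∧ ∃ (m : ℕ) (Φ : Vec p → Vec m), IsLocalDefiningMap M β Φ

/-- The tangent space of a `C²`-manifold `M` at `β`: the kernel of the derivative at `β` of a local
defining map. All local defining maps have the same kernel, so no choice among them is made. -/
def tangentSpaceOf {p : ℕ} (M : Set (Vec p)) (β : Vec p) : Submodule ℝ (Vec p) :=
  ⨅ (m : ℕ) (Φ : Vec p → Vec m) (_ : IsLocalDefiningMap M β Φ),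
    LinearMap.ker (fderiv ℝ Φ β : Vec p →ₗ[ℝ] Vec m)

/-- The restriction of `J` to `M` is `C²` around `β`: near `β`, it is the restriction of a function
that is `C²` around `β` in `ℝ^p`. -/
def IsC2AlongAround {p : ℕ} (J : Vec p → ℝ) (M : Set (Vec p)) (β : Vec p) : Prop :=
  ∃ g : Vec p → ℝ, ContDiffAt ℝ 2 g β ∧ ∀ᶠ x in 𝓝[M] β, J x = g x

/-- The set-valued map `S` is outer semicontinuous at `β` relative to `M`. -/
def OuterSemicontinuousRel {p : ℕ} (S : Vec p → Set (Vec p)) (M : Set (Vec p)) (β : Vec p) :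
    Prop :=
  ∀ x η : ℕ → Vec p, (∀ n, x n ∈ M) → Tendsto x atTop (𝓝 β) → (∀ n, η n ∈ S (x n)) →
    ∀ η₀ : Vec p, Tendsto η atTop (𝓝 η₀) → η₀ ∈ S β

/-- The set-valued map `S` is inner semicontinuous at `β` relative to `M`. -/
def InnerSemicontinuousRel {p : ℕ} (S : Vec p → Set (Vec p)) (M : Set (Vec p)) (β : Vec p) :
    Prop :=
  ∀ x : ℕ → Vec p, (∀ n, x n ∈ M) → Tendsto x atTop (𝓝 β) → ∀ η₀ ∈ S β,
    ∃ η : ℕ → Vec p, (∀ᶠ n in atTop, η n ∈ S (x n)) ∧ Tendsto η atTop (𝓝 η₀)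

/-- The (finite convex) function `J` is partly smooth at `β` relative to `M`. -/
structure IsPartlySmoothAt {p : ℕ} (J : Vec p → ℝ) (M : Set (Vec p)) (β : Vec p) : Prop where
  manifold : IsC2ManifoldAround M β
  smooth : IsC2AlongAround J M β
  sharp : tangentSpaceOf M β = modelSubspace J β
  outer : OuterSemicontinuousRel (subdiff J) M β
  inner : InnerSemicontinuousRel (subdiff J) M β

/-- The (finite convex) function `J` is locally partly smooth at `β` relative to `M`: `M` is a
`C²`-manifold containing `β`, and `J` is partly smooth relative to `M` at every point of `M`
near `β`. -/
structure IsLocallyPartlySmoothAt {p : ℕ} (J : Vec p → ℝ) (M : Set (Vec p)) (β : Vec p) :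
    Prop where
  mem : β ∈ M
  manifold : ∀ x ∈ M, IsC2ManifoldAround M x
  partlySmooth : ∃ U ∈ 𝓝 β, ∀ x ∈ M ∩ U, IsPartlySmoothAt J M x

/-! ### The optimization problems -/

/-- The objective `E(β, θ)` for `θ = (μ, u, Γ)` with `μ > 0`. -/
def energy {p : ℕ} (J : Vec p → ℝ) (μ : ℝ) (u : Vec p) (Γ : Matrix (Fin p) (Fin p) ℝ)
    (β : Vec p) : ℝ :=
  J β + 1 / (2 * μ) * ⟪op Γ β, β⟫_ℝ - 1 / μ * ⟪β, u⟫_ℝ + 1 / (2 * μ) * ⟪pinv (op Γ) u, u⟫_ℝ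

/-- `β` is a solution of the penalized problem with parameters `θ = (μ, u, Γ)`, `μ > 0`. -/
def IsSolution {p : ℕ} (J : Vec p → ℝ) (μ : ℝ) (u : Vec p) (Γ : Matrix (Fin p) (Fin p) ℝ)
    (β : Vec p) : Prop :=
  ∀ γ : Vec p, energy J μ u Γ β ≤ energy J μ u Γ γ

/-- `β` is a solution of the constrained problem with parameters `(0, u, Γ)`: it minimizes `J`
over `{γ | Γ γ = u}`. -/
def IsConstrainedSolution {p : ℕ} (J : Vec p → ℝ) (u : Vec p) (Γ : Matrix (Fin p) (Fin p) ℝ)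
    (β : Vec p) : Prop :=
  op Γ β = u ∧ ∀ γ : Vec p, op Γ γ = u → J β ≤ J γ

end PartlySmoothModel

end

namespace PartlySmoothModel

/-! ### Positive operators -/

/-! Argue by contradiction with solutions `β n ∈ M` whose parameters satisfy `μ n → 0`, `Γ n → Γt`
and `ε n = (u n - Γ n β₀) / μ n → 0`. Uniqueness of `β₀` forces `h n = β n - β₀ → 0`
(`tendsto_zero_of_le`). First-order optimality makes `η n = ε n - Γ n (h n) / μ n` a subgradient at
`β n`; these are bounded, so a subsequence tends to some `η₀ ∈ ∂J(β₀)`, and along it `Γ n (h n) / μ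
n → -η₀`. The `h n` are secants of `M` through `β₀`, so their limit directions lie in `T`; as `Γt`
is injective on `T`, the rate `‖h n‖ / μ n` is controlled and `-η₀ = Γt d` with `d ∈ T`
(`exists_tangent_of_tendsto`). Such an `η₀` can only be the pre-certificate (`preCertificate_eq`),
which was assumed not to be a subgradient. -/

theorem tendsto_clm_apply {E F : Type*} [NormedAddCommGroup E] [NormedSpace ℝ E]
    [NormedAddCommGroup F] [NormedSpace ℝ F] {A : ℕ → E →L[ℝ] F} {B : E →L[ℝ] F}
    {x : ℕ → E} {y : E} (hA : Tendsto A atTop (𝓝 B)) (hx : Tendsto x atTop (𝓝 y)) :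
    Tendsto (fun n => A n (x n)) atTop (𝓝 (B y)) :=
  (isBoundedBilinearMap_apply.continuous.tendsto (B, y)).comp (hA.prodMk_nhds hx)

theorem isPositive_op {p : ℕ} {Γ : Matrix (Fin p) (Fin p) ℝ} (hΓ : Γ.PosSemidef) :
    (op Γ).IsPositive := by
  rw [← ContinuousLinearMap.isPositive_toLinearMap_iff]
  exact Matrix.isPositive_toEuclideanLin_iff.2 hΓ

/-- The nonnegative quadratic form vanishes at `x`, hence is minimal there; its variation in the
direction `A x` has slope `2 * ‖A x‖ ^ 2`, which must be zero. -/
theorem apply_eq_zero_of_inner_self_eq_zero {E : Type*} [NormedAddCommGroup E]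
    [InnerProductSpace ℝ E] {A : E →L[ℝ] E} (hA : A.IsPositive) {x : E}
    (hx : ⟪A x, x⟫_ℝ = 0) : A x = 0 := by
  have hexp : ∀ t : ℝ, 0 ≤ 2 * t * ‖A x‖ ^ 2 + t ^ 2 * ⟪A (A x), A x⟫_ℝ := by
    intro t
    have h := hA.inner_nonneg_left (x + t • A x)
    have hs : ⟪A (A x), x⟫_ℝ = ‖A x‖ ^ 2 := by
      rw [hA.inner_left_eq_inner_right, real_inner_self_eq_norm_sq]
    simp only [map_add, map_smul, inner_add_left, inner_add_right, real_inner_smul_left,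
      real_inner_smul_right, hx, hs, real_inner_self_eq_norm_sq] at h
    linarith
  have hc : 0 ≤ ⟪A (A x), A x⟫_ℝ := hA.inner_nonneg_left _
  set c := ⟪A (A x), A x⟫_ℝ
  have hc1 : 0 < c + 1 := by linarith
  have h1 : ‖A x‖ ^ 2 ≤ 0 := by
    by_contra! hpos
    set a := ‖A x‖ ^ 2
    -- A small negative `t` makes the linear term dominate; the `+ 1` keeps the denominator positive
    -- when `c = 0`.
    have h3 := hexp (-(a / (c + 1)))
    have h4 : 2 * -(a / (c + 1)) * a + (-(a / (c + 1))) ^ 2 * c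
        = a ^ 2 / (c + 1) ^ 2 * (c - 2 * (c + 1)) := by
      field_simp
      ring
    rw [h4] at h3
    have h5 : 0 < a ^ 2 / (c + 1) ^ 2 := by positivity
    nlinarith
  have : ‖A x‖ = 0 := by nlinarith [norm_nonneg (A x)]
  exact norm_eq_zero.1 this

theorem isPositive_of_tendsto {E : Type*} [NormedAddCommGroup E] [InnerProductSpace ℝ E]
    {A : ℕ → E →L[ℝ] E} {B : E →L[ℝ] E} (hA : ∀ n, (A n).IsPositive)
    (h : Tendsto A atTop (𝓝 B)) : B.IsPositive := by
  have hx : ∀ x, Tendsto (fun n => A n x) atTop (𝓝 (B x)) := fun x =>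
    tendsto_clm_apply h tendsto_const_nhds
  refine ⟨fun x y => ?_, fun x => ?_⟩
  · refine tendsto_nhds_unique ((hx x).inner tendsto_const_nhds)
      (Tendsto.congr (fun n => ?_) (tendsto_const_nhds.inner (hx y)))
    exact ((hA n).inner_left_eq_inner_right x y).symm
  · exact ge_of_tendsto' ((hx x).inner tendsto_const_nhds) fun n => (hA n).inner_nonneg_left x

/-! ### The pre-certificate -/

/-- If `-η` is the image of a vector `d` of the model subspace, and `η` is a subgradient,
then `η` is the pre-certificate. -/
theorem preCertificate_eq {p : ℕ} {J : Vec p → ℝ} {β η d : Vec p}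
    {Γ : Matrix (Fin p) (Fin p) ℝ} (hpos : (op Γ).IsPositive)
    (hker : LinearMap.ker (op Γ).toLinearMap ⊓ modelSubspace J β = ⊥)
    (hη : η ∈ subdiff J β) (hd : d ∈ modelSubspace J β) (hΓd : op Γ d = -η) :
    preCertificate J β Γ = η := by
  set T := modelSubspace J β with hT
  set G := compress T Γ with hG
  have hGapp : ∀ x, G x = T.starProjection (op Γ (T.starProjection x)) := fun x => rfl
  have hPd : T.starProjection d = d := Submodule.starProjection_eq_self_iff.2 hd
  -- `G x = 0` kills the quadratic form of `Γ` at `P_T x`, so positivity puts `P_T x` in `ker Γ ∩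
  -- T`.
  have hkerG : ∀ x, G x = 0 → T.starProjection x = 0 := by
    intro x hx
    set y := T.starProjection x with hy
    have hyT : y ∈ T := T.starProjection_apply_mem x
    have h0 : ⟪op Γ y, y⟫_ℝ = 0 := by
      have h1 : ⟪T.starProjection (op Γ y), x⟫_ℝ = 0 := by rw [← hGapp, hx, inner_zero_left]
      rwa [Submodule.inner_starProjection_left_eq_right] at h1
    have h2 : y ∈ LinearMap.ker (op Γ).toLinearMap ⊓ T :=
      ⟨apply_eq_zero_of_inner_self_eq_zero hpos h0, hyT⟩
    rw [hker] at h2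
    exact h2
  have hGd : G d = -modelVector J β := by
    rw [hGapp, hPd, hΓd, map_neg, starProjection_eq_modelVector hη]
  have hMP := pinv_spec G
  set B := pinv G with hB
  set z := B (G d) - d with hz
  have hGz : G z = 0 := by
    have : G (B (G d)) = G d := congrArg (fun F : Vec p →L[ℝ] Vec p => F d) hMP.mul_mul_left
    rw [hz, map_sub, this, sub_self]
  have hPz : T.starProjection z = 0 := hkerG z hGz
  -- Both summands of `z` are orthogonal to `z`: `B (G d)` because `B * G` is self-adjoint and `G z
  -- = 0`, and `d` because it lies in `T` while `P_T z = 0`.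
  have hzz : ⟪z, z⟫_ℝ = 0 := by
    have h1 : ⟪B (G d), z⟫_ℝ = 0 := by
      have h2 := hMP.selfAdjoint_right.isSymmetric d z
      change ⟪B (G d), z⟫_ℝ = ⟪d, B (G z)⟫_ℝ at h2
      rw [h2, hGz, map_zero, inner_zero_right]
    have h3 : ⟪d, z⟫_ℝ = 0 := by
      rw [← hPd, Submodule.inner_starProjection_left_eq_right, hPz, inner_zero_right]
    nth_rewrite 1 [hz]
    rw [inner_sub_left, h1, h3, sub_zero]
  have hBd : B (G d) = d := sub_eq_zero.1 (inner_self_eq_zero.1 hzz)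
  have hBe : B (modelVector J β) = -d := by
    rw [← hBd, hGd, map_neg, neg_neg]
  change op Γ (B (modelVector J β)) = η
  rw [hBe, map_neg, hΓd, neg_neg]

/-! ### Subdifferential of a convex function -/

theorem continuous_of_convexOn {p : ℕ} {J : Vec p → ℝ} (hJ : ConvexOn ℝ univ J) :
    Continuous J := hJ.locallyLipschitz.continuous

theorem subdiff_closed {p : ℕ} {J : Vec p → ℝ} (hJ : Continuous J) {x η : ℕ → Vec p}
    {β η₀ : Vec p} (hx : Tendsto x atTop (𝓝 β)) (hη : Tendsto η atTop (𝓝 η₀))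
    (hmem : ∀ n, η n ∈ subdiff J (x n)) : η₀ ∈ subdiff J β := by
  intro γ
  exact le_of_tendsto' (((hJ.tendsto β).comp hx).add (hη.inner (tendsto_const_nhds.sub hx)))
    fun n => hmem n γ

/-- Subgradients at points of a bounded set are bounded. -/
theorem exists_norm_subdiff_le {p : ℕ} {J : Vec p → ℝ} (hJ : Continuous J) (β : Vec p) (r : ℝ) :
    ∃ K, ∀ x ∈ Metric.closedBall β r, ∀ η ∈ subdiff J x, ‖η‖ ≤ K := by
  obtain ⟨K, hK⟩ := (isCompact_closedBall β (r + 1)).exists_bound_of_continuousOn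
    hJ.continuousOn
  -- A unit step along `η` raises `J` by at least `‖η‖`, while `|J| ≤ K` on the ball enlarged by 1.
  refine ⟨2 * K, fun x hx η hη => ?_⟩
  have hx' : x ∈ Metric.closedBall β (r + 1) :=
    Metric.closedBall_subset_closedBall (by linarith) hx
  set v := ‖η‖⁻¹ • η with hv
  have hv1 : ‖v‖ ≤ 1 := by
    rw [hv, norm_smul, norm_inv, norm_norm]
    exact inv_mul_le_one
  have hxv : x + v ∈ Metric.closedBall β (r + 1) := by
    rw [mem_closedBall_iff_norm] at hx ⊢
    calc ‖x + v - β‖ = ‖(x - β) + v‖ := by congr 1; abel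
      _ ≤ ‖x - β‖ + ‖v‖ := norm_add_le _ _
      _ ≤ r + 1 := add_le_add hx hv1
  have h := hη (x + v)
  have hin : ⟪η, x + v - x⟫_ℝ = ‖η‖ := by
    rw [add_sub_cancel_left, hv, real_inner_smul_right, real_inner_self_eq_norm_sq]
    rcases eq_or_ne ‖η‖ 0 with h0 | h0
    · simp [h0]
    · field_simp
  rw [hin] at h
  have h1 := hK _ hx'
  have h2 := hK _ hxv
  rw [Real.norm_eq_abs, abs_le] at h1 h2
  linarith

/-! ### Optimality conditions for the penalized problem -/

theorem energy_sub {p : ℕ} (J : Vec p → ℝ) (μ : ℝ) (u : Vec p)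
    {Γ : Matrix (Fin p) (Fin p) ℝ} (hΓ : (op Γ).IsPositive) (β γ : Vec p) :
    energy J μ u Γ γ - energy J μ u Γ β
      = J γ - J β + 1 / (2 * μ) * ⟪op Γ (γ - β), γ - β⟫_ℝ
        - 1 / μ * ⟪u - op Γ β, γ - β⟫_ℝ := by
  have hs : ⟪op Γ γ, β⟫_ℝ = ⟪op Γ β, γ⟫_ℝ := by
    rw [hΓ.inner_left_eq_inner_right, real_inner_comm]
  simp only [energy, map_sub, inner_sub_left, inner_sub_right, hs]
  rw [real_inner_comm u γ, real_inner_comm u β]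
  ring

/-- Compare the energy at `β` with that at `β + t • (γ - β)`: convexity bounds the change of `J`
linearly in `t`, the quadratic term is of order `t ^ 2`, and dividing by `t → 0+` removes it. -/
theorem IsSolution.smul_mem_subdiff {p : ℕ} {J : Vec p → ℝ} (hJ : ConvexOn ℝ univ J) {μ : ℝ}
    {u : Vec p} {Γ : Matrix (Fin p) (Fin p) ℝ} (hΓ : (op Γ).IsPositive) {β : Vec p}
    (h : IsSolution J μ u Γ β) : μ⁻¹ • (u - op Γ β) ∈ subdiff J β := by
  intro γ
  set v := γ - β with hv
  set q := 1 / (2 * μ) * ⟪op Γ v, v⟫_ℝ with hq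
  set b := ⟪μ⁻¹ • (u - op Γ β), v⟫_ℝ with hb
  have key : ∀ t ∈ Ioc (0 : ℝ) 1, b - t * q ≤ J γ - J β := by
    rintro t ⟨ht0, ht1⟩
    have h1 := sub_nonneg.2 (h (β + t • v))
    rw [energy_sub J μ u hΓ, add_sub_cancel_left, map_smul, real_inner_smul_left,
      real_inner_smul_right, real_inner_smul_right] at h1
    have hb' : b = 1 / μ * ⟪u - op Γ β, v⟫_ℝ := by
      rw [hb, real_inner_smul_left, one_div]
    have hc : J (β + t • v) ≤ (1 - t) * J β + t * J γ := by
      have := hJ.2 (mem_univ β) (mem_univ γ) (sub_nonneg.2 ht1) ht0.le (by ring)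
      have he : (1 - t) • β + t • γ = β + t • v := by rw [hv]; module
      rwa [he] at this
    have h2 : t * (b - t * q) ≤ t * (J γ - J β) := by
      rw [hb', hq]
      linarith
    exact le_of_mul_le_mul_left h2 ht0
  have hlim : Tendsto (fun t : ℝ => b - t * q) (𝓝[>] 0) (𝓝 b) := by
    have : Continuous fun t : ℝ => b - t * q := by fun_prop
    have h0 := (this.tendsto 0).mono_left (nhdsWithin_le_nhds (s := Ioi 0))
    simpa using h0
  have := le_of_tendsto hlim (by
    filter_upwards [Ioc_mem_nhdsGT (zero_lt_one' ℝ)] with t ht using key t ht)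
  linarith

/-- A comparison of the energy of a solution with that of `β₀`. -/
theorem IsSolution.le_add_inner {p : ℕ} {J : Vec p → ℝ} {μ : ℝ}
    {u : Vec p} {Γ : Matrix (Fin p) (Fin p) ℝ} (hΓ : (op Γ).IsPositive) {β : Vec p}
    (h : IsSolution J μ u Γ β) (β₀ : Vec p) :
    J β + 1 / (2 * μ) * ⟪op Γ (β - β₀), β - β₀⟫_ℝ
      ≤ J β₀ + ⟪μ⁻¹ • (u - op Γ β₀), β - β₀⟫_ℝ := by
  have h1 := sub_nonpos.2 (h β₀)
  rw [energy_sub J μ u hΓ] at h1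
  rw [real_inner_smul_left, ← one_div]
  linarith

/-! ### Convergence of approximate minimizers -/

/-- A priori `h` need not even be bounded. Convexity transfers the inequality to the points of the
segments at distance `δ` from `β₀`, where compactness yields a nonzero limit `k₀` with `B k₀ = 0`
and `J (β₀ + k₀) ≤ J β₀`. -/
theorem tendsto_zero_of_le {p : ℕ} {J : Vec p → ℝ} (hJ : ConvexOn ℝ univ J) {β₀ : Vec p}
    {A : ℕ → Vec p →L[ℝ] Vec p} {B : Vec p →L[ℝ] Vec p} (hA : ∀ n, (A n).IsPositive)
    (hAB : Tendsto A atTop (𝓝 B)) (hB : ∀ k, B k = 0 → J (β₀ + k) ≤ J β₀ → k = 0)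
    {μ : ℕ → ℝ} (hμ : ∀ n, 0 < μ n) (hμ0 : Tendsto μ atTop (𝓝 0))
    {ε h : ℕ → Vec p} (hε : Tendsto ε atTop (𝓝 0))
    (hle : ∀ n, J (β₀ + h n) + 1 / (2 * μ n) * ⟪A n (h n), h n⟫_ℝ ≤ J β₀ + ⟪ε n, h n⟫_ℝ) :
    Tendsto h atTop (𝓝 0) := by
  have hJc := continuous_of_convexOn hJ
  by_contra hcon
  rw [Metric.tendsto_atTop] at hcon
  push Not at hcon
  obtain ⟨δ, hδ, hfar⟩ := hcon
  obtain ⟨φ, hφ, hφfar⟩ := extraction_of_frequently_atTop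
    (frequently_atTop.2 fun N => (hfar N).imp fun n hn => ⟨hn.1, hn.2⟩)
  set k : ℕ → Vec p := fun n => (δ / ‖h (φ n)‖) • h (φ n) with hk
  have hfar' : ∀ n, δ ≤ ‖h (φ n)‖ := fun n => by simpa [dist_zero_right] using hφfar n
  have hkn : ∀ n, k n ∈ Metric.sphere (0 : Vec p) δ := fun n => by
    have : 0 < ‖h (φ n)‖ := hδ.trans_le (hfar' n)
    rw [mem_sphere_zero_iff_norm, hk]
    simp only [norm_smul, norm_div, Real.norm_eq_abs, abs_of_pos hδ, abs_norm]
    field_simp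
  have hkle : ∀ n, J (β₀ + k n) + 1 / (2 * μ (φ n)) * ⟪A (φ n) (k n), k n⟫_ℝ
      ≤ J β₀ + ⟪ε (φ n), k n⟫_ℝ := by
    intro n
    have hpos : 0 < ‖h (φ n)‖ := hδ.trans_le (hfar' n)
    set t := δ / ‖h (φ n)‖ with ht
    have ht0 : 0 < t := by positivity
    have ht1 : t ≤ 1 := (div_le_one hpos).2 (hfar' n)
    have hc := hJ.2 (mem_univ β₀) (mem_univ (β₀ + h (φ n))) (sub_nonneg.2 ht1) ht0.le (by ring)
    have he : (1 - t) • β₀ + t • (β₀ + h (φ n)) = β₀ + k n := by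
      change _ = β₀ + t • h (φ n)
      module
    rw [he, smul_eq_mul, smul_eq_mul] at hc
    have hq : 0 ≤ 1 / (2 * μ (φ n)) * ⟪A (φ n) (h (φ n)), h (φ n)⟫_ℝ := by
      have h1 := (hA (φ n)).inner_nonneg_left (h (φ n))
      have h2 := hμ (φ n)
      positivity
    have hkt : k n = t • h (φ n) := rfl
    have hl := mul_le_mul_of_nonneg_left (hle (φ n)) ht0.le
    rw [hkt] at hc ⊢
    rw [map_smul, real_inner_smul_left, real_inner_smul_right, real_inner_smul_right]
    set q := ⟪A (φ n) (h (φ n)), h (φ n)⟫_ℝ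
    -- The quadratic term scales by `t ^ 2 ≤ t`, the other terms by `t`.
    have hq2 : t * (t * (1 / (2 * μ (φ n)) * q)) ≤ t * (1 / (2 * μ (φ n)) * q) :=
      mul_le_mul_of_nonneg_left (mul_le_of_le_one_left hq ht1) ht0.le
    linarith
  obtain ⟨k₀, hk₀, ψ, hψ, hlim⟩ := (isCompact_sphere (0 : Vec p) δ).tendsto_subseq hkn
  have hsub : Tendsto (φ ∘ ψ) atTop atTop := (hφ.comp hψ).tendsto_atTop
  have hAk : Tendsto (fun n => A (φ (ψ n)) (k (ψ n))) atTop (𝓝 (B k₀)) :=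
    tendsto_clm_apply (hAB.comp hsub) hlim
  have hJk : Tendsto (fun n => J (β₀ + k (ψ n))) atTop (𝓝 (J (β₀ + k₀))) :=
    (hJc.tendsto _).comp (tendsto_const_nhds.add hlim)
  have hεk : Tendsto (fun n => ⟪ε (φ (ψ n)), k (ψ n)⟫_ℝ) atTop (𝓝 0) := by
    simpa using (hε.comp hsub).inner hlim
  have hJle : J (β₀ + k₀) ≤ J β₀ := by
    refine le_of_tendsto_of_tendsto' hJk (by simpa using tendsto_const_nhds.add hεk) fun n => ?_
    have h1 := (hA (φ (ψ n))).inner_nonneg_left (k (ψ n))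
    have h2 := hμ (φ (ψ n))
    have h3 : 0 ≤ 1 / (2 * μ (φ (ψ n))) * ⟪A (φ (ψ n)) (k (ψ n)), k (ψ n)⟫_ℝ := by positivity
    have := hkle (ψ n)
    change J (β₀ + k (ψ n)) ≤ J β₀ + ⟪ε (φ (ψ n)), k (ψ n)⟫_ℝ
    linarith
  have hpos := isPositive_of_tendsto hA hAB
  -- Multiplying the inequality by `2 * μ` leaves a convergent bracket times a factor tending to
  -- zero.
  have hq0 : ⟪B k₀, k₀⟫_ℝ ≤ 0 := by
    have hr : Tendsto (fun n => 2 * μ (φ (ψ n)) *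
        (J β₀ + ⟪ε (φ (ψ n)), k (ψ n)⟫_ℝ - J (β₀ + k (ψ n)))) atTop (𝓝 0) := by
      have h1 : Tendsto (fun n => 2 * μ (φ (ψ n))) atTop (𝓝 0) := by
        simpa using (hμ0.comp hsub).const_mul 2
      simpa using h1.mul ((tendsto_const_nhds (x := J β₀)).add hεk |>.sub hJk)
    refine le_of_tendsto_of_tendsto' (hAk.inner hlim) hr fun n => ?_
    have h2 := hμ (φ (ψ n))
    have h3 := hkle (ψ n)
    have h4 : 1 / (2 * μ (φ (ψ n))) * ⟪A (φ (ψ n)) (k (ψ n)), k (ψ n)⟫_ℝ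
        ≤ J β₀ + ⟪ε (φ (ψ n)), k (ψ n)⟫_ℝ - J (β₀ + k (ψ n)) := by linarith
    rwa [one_div, inv_mul_le_iff₀ (by positivity)] at h4
  have hBk : B k₀ = 0 := apply_eq_zero_of_inner_self_eq_zero hpos
    (le_antisymm hq0 (hpos.inner_nonneg_left k₀))
  have hk0 := hB k₀ hBk hJle
  rw [hk0, mem_sphere_zero_iff_norm, norm_zero] at hk₀
  exact hδ.ne hk₀

/-! ### Tangent directions of a manifold -/

/-- A limit of normalized secants through `β` lies in the tangent space at `β`. -/
theorem mem_tangentSpaceOf_of_tendsto {p : ℕ} {M : Set (Vec p)} {β : Vec p} (hβ : β ∈ M)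
    {h : ℕ → Vec p} (hM : ∀ n, β + h n ∈ M) (hh : Tendsto h atTop (𝓝 0)) {k : Vec p}
    (hk : Tendsto (fun n => ‖h n‖⁻¹ • h n) atTop (𝓝 k)) : k ∈ tangentSpaceOf M β := by
  simp only [tangentSpaceOf, Submodule.mem_iInf]
  intro m Φ hΦ
  have hD : HasFDerivAt Φ (fderiv ℝ Φ β) β :=
    (hΦ.contDiffAt.differentiableAt (by norm_num)).hasFDerivAt
  have hlim : Tendsto (fun n => β + h n) atTop (𝓝 β) := by
    simpa using tendsto_const_nhds.add hh
  have hΦβ : Φ β = 0 := (hΦ.mem_iff.self_of_nhds).1 hβ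
  have ho := (hasFDerivAt_iff_isLittleO.1 hD).comp_tendsto hlim
  -- `Φ` vanishes at `β` and at `β + h n`, so only the derivative term remains in the expansion, and
  -- it is `o(h)`.
  have ho' : Tendsto (fun n => ‖h n‖⁻¹ • fderiv ℝ Φ β (h n)) atTop (𝓝 0) := by
    have h1 : (fun n => fderiv ℝ Φ β (h n)) =o[atTop] h := by
      refine ho.neg_left.congr' ?_ (Eventually.of_forall fun n => ?_)
      · filter_upwards [hlim.eventually hΦ.mem_iff] with n hn
        simp [hn.1 (hM n), hΦβ]
      · simp
    rw [tendsto_zero_iff_norm_tendsto_zero]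
    refine h1.norm_norm.tendsto_div_nhds_zero.congr fun n => ?_
    rw [norm_smul, norm_inv, norm_norm, div_eq_inv_mul]
  have hk' := ((fderiv ℝ Φ β).continuous.tendsto k).comp hk
  refine tendsto_nhds_unique hk' (ho'.congr fun n => ?_)
  simp

/-- If the images of scaled secants converge, and the limit operator is injective on the tangent
space, then the limit is the image of a tangent vector. -/
theorem exists_tangent_of_tendsto {p : ℕ} {M : Set (Vec p)} {β : Vec p} (hβ : β ∈ M)
    {h : ℕ → Vec p} (hM : ∀ n, β + h n ∈ M) (hh : Tendsto h atTop (𝓝 0))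
    {A : ℕ → Vec p →L[ℝ] Vec p} {B : Vec p →L[ℝ] Vec p} (hAB : Tendsto A atTop (𝓝 B))
    (hker : LinearMap.ker B.toLinearMap ⊓ tangentSpaceOf M β = ⊥)
    {μ : ℕ → ℝ} (hμ : ∀ n, 0 < μ n) {ξ : Vec p}
    (hξ : Tendsto (fun n => (μ n)⁻¹ • A n (h n)) atTop (𝓝 ξ)) :
    ∃ d ∈ tangentSpaceOf M β, B d = ξ := by
  have hball : ∀ n, ‖h n‖⁻¹ • h n ∈ Metric.closedBall (0 : Vec p) 1 := fun n => by
    rw [mem_closedBall_zero_iff, norm_smul, norm_inv, norm_norm]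
    exact inv_mul_le_one
  obtain ⟨k, -, φ, hφ, hlim⟩ := (isCompact_closedBall (0 : Vec p) 1).tendsto_subseq hball
  have hkT : k ∈ tangentSpaceOf M β :=
    mem_tangentSpaceOf_of_tendsto hβ (fun n => hM (φ n)) (hh.comp hφ.tendsto_atTop) hlim
  have hξφ := hξ.comp hφ.tendsto_atTop
  have hAk : Tendsto (fun n => A (φ n) (‖h (φ n)‖⁻¹ • h (φ n))) atTop (𝓝 (B k)) :=
    tendsto_clm_apply (hAB.comp hφ.tendsto_atTop) hlim
  have hscale : ∀ n, ((μ (φ n))⁻¹ * ‖h (φ n)‖) • A (φ n) (‖h (φ n)‖⁻¹ • h (φ n))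
      = (μ (φ n))⁻¹ • A (φ n) (h (φ n)) := by
    intro n
    rcases eq_or_ne (h (φ n)) 0 with h0 | h0
    · simp [h0]
    · rw [map_smul, smul_smul, mul_assoc, mul_inv_cancel₀ (norm_ne_zero_iff.2 h0), mul_one]
  by_cases hBk : B k = 0
  · have hk0 : k = 0 := by
      have : k ∈ LinearMap.ker B.toLinearMap ⊓ tangentSpaceOf M β := ⟨hBk, hkT⟩
      rwa [hker] at this
    refine ⟨0, Submodule.zero_mem _, ?_⟩
    rw [map_zero]
    -- Normalized secants have norm 1, or 0 when `h` vanishes (since `0⁻¹ = 0`); limit 0 therefore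
    -- means `h` is eventually zero along `φ`, and so `ξ = 0`.
    have hev : ∀ᶠ n in atTop, ‖‖h (φ n)‖⁻¹ • h (φ n)‖ < 1 := by
      have := hlim.norm
      rw [hk0, norm_zero] at this
      exact this.eventually (gt_mem_nhds zero_lt_one)
    refine tendsto_nhds_unique (tendsto_const_nhds.congr' ?_) hξφ
    filter_upwards [hev] with n hn
    have h0 : h (φ n) = 0 := by
      by_contra h0
      rw [norm_smul, norm_inv, norm_norm, inv_mul_cancel₀ (norm_ne_zero_iff.2 h0)] at hn
      exact lt_irrefl _ hn
    simp [h0]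
  -- Since `B k ≠ 0`, taking norms in `hscale` determines the limit of the rate `‖h‖ / μ`.
  · have hs : Tendsto (fun n => (μ (φ n))⁻¹ * ‖h (φ n)‖) atTop (𝓝 (‖ξ‖ / ‖B k‖)) := by
      refine (hξφ.norm.div hAk.norm (norm_ne_zero_iff.2 hBk)).congr' ?_
      filter_upwards [hAk.eventually_ne hBk] with n hn
      have hs0 : 0 ≤ (μ (φ n))⁻¹ * ‖h (φ n)‖ :=
        mul_nonneg (inv_nonneg.2 (hμ _).le) (norm_nonneg _)
      change ‖(μ (φ n))⁻¹ • A (φ n) (h (φ n))‖ / _ = _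
      rw [← hscale n, norm_smul, Real.norm_of_nonneg hs0, mul_div_cancel_right₀ _
        (norm_ne_zero_iff.2 hn)]
    refine ⟨(‖ξ‖ / ‖B k‖) • k, Submodule.smul_mem _ _ hkT, ?_⟩
    rw [map_smul]
    exact tendsto_nhds_unique (hs.smul hAk) (hξφ.congr fun n => (hscale n).symm)

end PartlySmoothModel

/-! ### The contradiction argument -/

open PartlySmoothModel in
theorem proposition1 {p : ℕ} (J : PartlySmoothModel.Vec p → ℝ) (hJ : ConvexOn ℝ Set.univ J)
    (β₀ : PartlySmoothModel.Vec p) (M : Set (PartlySmoothModel.Vec p))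
    (hM : PartlySmoothModel.IsLocallyPartlySmoothAt J M β₀)
    (Γt : Matrix (Fin p) (Fin p) ℝ)
    (hsol : PartlySmoothModel.IsConstrainedSolution J (PartlySmoothModel.op Γt β₀) Γt β₀)
    (huniq : ∀ β : PartlySmoothModel.Vec p,
      PartlySmoothModel.IsConstrainedSolution J (PartlySmoothModel.op Γt β₀) Γt β → β = β₀)
    (hker : LinearMap.ker (PartlySmoothModel.op Γt).toLinearMap ⊓
      PartlySmoothModel.modelSubspace J β₀ = ⊥)
    (hη : PartlySmoothModel.preCertificate J β₀ Γt ∉ PartlySmoothModel.subdiff J β₀) :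
    ∃ C : ℝ, 0 < C ∧
      ∀ (μ : ℝ) (u : PartlySmoothModel.Vec p) (Γ : Matrix (Fin p) (Fin p) ℝ),
        0 < μ → Γ.PosSemidef →
        max ‖PartlySmoothModel.op (Γ - Γt)‖
          (max (‖u - PartlySmoothModel.op Γ β₀‖ * μ⁻¹) μ) ≤ C →
        ∀ β : PartlySmoothModel.Vec p,
          PartlySmoothModel.IsSolution J μ u Γ β → β ∉ M := by
  by_contra! hcon
  choose μ u Γ hμ hΓ hmax β hβ hβM using fun n : ℕ =>
    hcon (1 / ((n : ℝ) + 1)) Nat.one_div_pos_of_nat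
  have hC : Tendsto (fun n : ℕ => 1 / ((n : ℝ) + 1)) atTop (𝓝 0) :=
    tendsto_one_div_add_atTop_nhds_zero_nat
  have hpos : ∀ n, (op (Γ n)).IsPositive := fun n => isPositive_op (hΓ n)
  have hΓlim : Tendsto (fun n => op (Γ n)) atTop (𝓝 (op Γt)) := by
    rw [tendsto_iff_norm_sub_tendsto_zero]
    refine squeeze_zero (fun _ => norm_nonneg _) (fun n => ?_) hC
    rw [← map_sub]
    exact (le_max_left _ _).trans (hmax n)
  have hμ0 : Tendsto μ atTop (𝓝 0) :=
    squeeze_zero (fun n => (hμ n).le)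
      (fun n => ((le_max_right _ _).trans (le_max_right _ _)).trans (hmax n)) hC
  set ε : ℕ → Vec p := fun n => (μ n)⁻¹ • (u n - op (Γ n) β₀) with hε
  have hε0 : Tendsto ε atTop (𝓝 0) := by
    refine squeeze_zero_norm (fun n => ?_) hC
    rw [hε, norm_smul, Real.norm_of_nonneg (inv_nonneg.2 (hμ n).le), mul_comm]
    exact ((le_max_left _ _).trans (le_max_right _ _)).trans (hmax n)
  have hpost := isPositive_of_tendsto hpos hΓlim
  have hJc := continuous_of_convexOn hJ
  set h : ℕ → Vec p := fun n => β n - β₀ with hh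
  have hβh : ∀ n, β₀ + h n = β n := fun n => add_sub_cancel _ _
  have hh0 : Tendsto h atTop (𝓝 0) := by
    refine tendsto_zero_of_le hJ (β₀ := β₀) hpos hΓlim (fun k hk hle => ?_) hμ hμ0 hε0 fun n => ?_
    -- A kernel direction that does not increase `J` gives another constrained minimizer.
    · have := huniq (β₀ + k) ⟨by rw [map_add, hk, add_zero],
        fun γ hγ => hle.trans (hsol.2 γ hγ)⟩
      simpa using this
    · rw [hβh]
      exact (hβ n).le_add_inner (hpos n) β₀
  have hβlim : Tendsto β atTop (𝓝 β₀) := tendsto_sub_nhds_zero_iff.1 hh0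
  set η : ℕ → Vec p := fun n => (μ n)⁻¹ • (u n - op (Γ n) (β n)) with hηdef
  have hηmem : ∀ n, η n ∈ subdiff J (β n) := fun n => (hβ n).smul_mem_subdiff hJ (hpos n)
  obtain ⟨K, hK⟩ := exists_norm_subdiff_le hJc β₀ 1
  have hηK : ∃ᶠ n in atTop, η n ∈ Metric.closedBall (0 : Vec p) K := by
    refine Eventually.frequently ?_
    filter_upwards [hβlim.eventually (Metric.closedBall_mem_nhds β₀ one_pos)] with n hn
    exact mem_closedBall_zero_iff.2 (hK _ hn _ (hηmem n))
  obtain ⟨η₀, -, φ, hφ, hφlim⟩ :=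
    (isCompact_closedBall (0 : Vec p) K).tendsto_subseq' hηK
  have hη₀ : η₀ ∈ subdiff J β₀ :=
    subdiff_closed hJc (hβlim.comp hφ.tendsto_atTop) hφlim fun n => hηmem (φ n)
  obtain ⟨U, hU, hps⟩ := hM.partlySmooth
  have hsharp := (hps β₀ ⟨hM.mem, mem_of_mem_nhds hU⟩).sharp
  rw [← hsharp] at hker
  obtain ⟨d, hdT, hd⟩ := exists_tangent_of_tendsto hM.mem (h := h ∘ φ) (ξ := -η₀)
    (fun n => by simpa [hβh] using hβM (φ n)) (hh0.comp hφ.tendsto_atTop)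
    (hΓlim.comp hφ.tendsto_atTop) hker (fun n => hμ (φ n)) (by
      -- Uses the identity `ε n - η n = (μ n)⁻¹ • Γ n (h n)`.
      have h1 := (hε0.comp hφ.tendsto_atTop).sub hφlim
      rw [zero_sub] at h1
      refine h1.congr fun n => ?_
      simp only [hε, hηdef, hh, Function.comp_apply, map_sub]
      module)
  rw [hsharp] at hdT hker
  exact hη (preCertificate_eq hpost hker hη₀ hdT hd ▸ hη₀)
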